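/- Let $X$ be a homogeneous compactum, that is, a compact Hausdorff space such that for all $x, y \in X$ there is a homeomorphism $h : X \to X$ with $h(x) = y$. Suppose that $X$ is the union of countably many subspaces, each of which is dense in $X$ and countably tight. (A space $Y$ is countably tight if for every $A \subseteq Y$ and every $x \in \overline{A}$ there is a countable $B \subseteq A$ with $x \in \overline{B}$.) Let $X_\delta$ be the set $X$ with the $G_\delta$ topology, that is, the topology having the countable intersections of open subsets of $X$ as a base, and for a space $Y$ let $L(Y)$ be its Lindelöf number, the least infinite cardinal $\kappa$ such that every open cover of $Y$ has a subcover of cardinality at most $\kappa$. Then $$L(X_\delta) \leq 2^{\omega}.$$ -/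

import Mathlib

open Set
open scoped Cardinal

universe u

/-- The `G_δ` topology on `X`: the countable intersections of open sets form a base. -/
@[reducible] def gdeltaTopology (X : Type u) [TopologicalSpace X] : TopologicalSpace X :=
  TopologicalSpace.generateFrom {s : Set X | IsGδ s}

/-- The Lindelöf number `L(X)`: the least infinite cardinal `κ` such that every open cover of `X`
has a subcover of cardinality at most `κ`. -/
noncomputable def lindelofNumber (X : Type u) [TopologicalSpace X] : Cardinal.{u} :=
  sInf {κ : Cardinal.{u} | ℵ₀ ≤ κ ∧
    ∀ 𝒰 : Set (Set X), (∀ U ∈ 𝒰, IsOpen U) → ⋃₀ 𝒰 = univ →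
      ∃ 𝒱 ⊆ 𝒰, ⋃₀ 𝒱 = univ ∧ #𝒱 ≤ κ}

/-- A space is countably tight if every point in the closure of a set `A` is in the closure of
a countable subset of `A`. -/
def CountablyTight (X : Type u) [TopologicalSpace X] : Prop :=
  ∀ (A : Set X) (x : X), x ∈ closure A → ∃ B ⊆ A, B.Countable ∧ x ∈ closure B

/-- A space is homogeneous if any point can be mapped to any other point by an
autohomeomorphism. -/
def HomogeneousSpace (X : Type u) [TopologicalSpace X] : Prop :=
  ∀ x y : X, ∃ h : X ≃ₜ X, h x = y

/-! In fact `X` has at most `𝔠` points, which bounds the Lindelöf number of any topology on it.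

If no point has a countable local `π`-base, there are `ω₁` independent pairs of disjoint closed sets
(`dyadic_univ_of_not_hasCountablePiBaseAt`), which a cover by countably many countably tight sets
forbids (`not_dyadicOn_of_countablyTight_cover`). By homogeneity every point then has a countable
`π`-base, so it lies in the closure of a countable subset of each dense piece.

A free-sequence argument gives a nonempty `G_δ` set inside the closure of a countable set
(`exists_isGδ_subset_closure_countable`), and homogeneity puts one around every point. Closures of
countable sets can therefore be separated by `𝔠` open sets, and closing off yields a dense set of
size at most `𝔠` (`exists_dense_mk_le_continuum`). A point is determined by a sequence in this dense
set that picks from its transported `π`-base, so `#X ≤ 𝔠 ^ ℵ₀ = 𝔠`. -/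

/-- The point `x` has a countable local `π`-base. -/
def HasCountablePiBaseAt {X : Type*} [TopologicalSpace X] (x : X) : Prop :=
  ∃ V : ℕ → Set X, (∀ i, IsOpen (V i) ∧ (V i).Nonempty) ∧
    ∀ O, IsOpen O → x ∈ O → ∃ i, V i ⊆ O

/-- The pair of open sets `G false`, `G true` has disjoint closures, and both sets meet every
member of `𝒰`. -/
def Splits {X : Type*} [TopologicalSpace X] (𝒰 : Set (Set X)) (G : Bool → Set X) : Prop :=
  (∀ b, IsOpen (G b)) ∧ Disjoint (closure (G false)) (closure (G true)) ∧
    ∀ U ∈ 𝒰, ∀ b, (U ∩ G b).Nonempty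

/-- The closed set `F` meets every branch of a family, indexed by `I`, of pairs of disjoint closed
sets. -/
def DyadicOn {X : Type*} [TopologicalSpace X] (I : Type*) (F : Set X) : Prop :=
  ∃ B : I → Bool → Set X, (∀ i b, IsClosed (B i b)) ∧ (∀ i, Disjoint (B i false) (B i true)) ∧
    ∀ g : I → Bool, (F ∩ ⋂ i, B i (g i)).Nonempty

/-! ### Order type `ω₁`, transfinite choice and compactness -/

theorem exists_omega_one_order : ∃ (I : Type) (_ : LinearOrder I) (_ : WellFoundedLT I),
    (∀ a : I, (Iio a).Countable) ∧ (∀ S : Set I, S.Countable → ∃ c, ∀ a ∈ S, a < c) ∧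
      Nonempty (I ⊕ I ⊕ I ≃ I) := by
  have hcard : #(Ordinal.ToType (ℵ₁).ord) = ℵ₁ := by simp
  have hle : ℵ₀ ≤ (ℵ₁ : Cardinal.{0}) := Cardinal.aleph0_le_aleph 1
  have hIio : ∀ a : Ordinal.ToType (ℵ₁).ord, (Iio a).Countable := by
    intro a
    have h := (Cardinal.mk_Iio_lt a (by simp)).trans_eq hcard
    rw [← Cardinal.le_aleph0_iff_set_countable]
    exact Order.lt_succ_iff.1 (h.trans_eq Cardinal.succ_aleph0.symm)
  refine ⟨Ordinal.ToType (ℵ₁).ord, inferInstance, inferInstance, hIio, ?_, ?_⟩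
  · intro S hS
    by_contra! h
    have hu : (univ : Set (Ordinal.ToType (ℵ₁).ord)) ⊆ ⋃ a ∈ S, insert a (Iio a) := by
      intro c _
      obtain ⟨a, ha, hc⟩ := h c
      simp only [mem_iUnion, mem_insert_iff, mem_Iio]
      exact ⟨a, ha, hc.eq_or_lt⟩
    have hc : (univ : Set (Ordinal.ToType (ℵ₁).ord)).Countable :=
      (hS.biUnion fun a _ => (hIio a).insert a).mono hu
    rw [← Cardinal.le_aleph0_iff_set_countable, Cardinal.mk_univ, hcard] at hc
    exact absurd Cardinal.aleph0_lt_aleph_one (not_lt.2 hc)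
  · rw [← Cardinal.eq, ← Cardinal.add_def, ← Cardinal.add_def, hcard,
      Cardinal.add_eq_self hle, Cardinal.add_eq_self hle]

/-- Transfinite choice: at each stage a value with the required relation to the set of earlier
values is chosen, if there is one. -/
theorem exists_wellFounded_choice {I Y : Type*} [LinearOrder I] [WellFoundedLT I] [Nonempty Y]
    (Q : Set Y → Y → Prop) :
    ∃ f : I → Y, ∀ a, (∃ y, Q (f '' Iio a) y) → Q (f '' Iio a) (f a) := by
  classical
  let step : (a : I) → ((b : I) → b < a → Y) → Y := fun a past =>
    Classical.epsilon (Q {y | ∃ b, ∃ h : b < a, past b h = y})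
  let f : I → Y := (wellFounded_lt (α := I)).fix step
  refine ⟨f, fun a h => ?_⟩
  have hfa : f a = Classical.epsilon (Q (f '' Iio a)) := by
    have : f a = step a fun b _ => f b := (wellFounded_lt (α := I)).fix_eq step a
    rw [this]
    simp only [step]
    congr 2
    ext y
    simp
  rw [hfa]
  exact Classical.epsilon_spec h

/-- Compactness of a branch: finite intersections suffice. -/
theorem inter_iInter_nonempty_of_finite {X I : Type*} [TopologicalSpace X] [CompactSpace X]
    {F : Set X} (hF : IsClosed F) (B : I → Set X) (hB : ∀ i, IsClosed (B i))
    (h : ∀ J : Finset I, (F ∩ ⋂ i ∈ J, B i).Nonempty) : (F ∩ ⋂ i, B i).Nonempty :=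
  hF.isCompact.inter_iInter_nonempty B hB h

theorem DyadicOn.nonempty {X : Type*} [TopologicalSpace X] {I : Type*} {F : Set X}
    (h : DyadicOn I F) : F.Nonempty := by
  obtain ⟨B, -, -, h⟩ := h
  exact (h fun _ => true).mono inter_subset_left

/-! ### Independent pairs from the absence of countable `π`-bases -/

/-- Among the members of `𝒰`, take `U` whose closure is covered by the fewest open sets that contain
no member of `𝒰`. Shrink one covering set `W`, and the union of the others, to `P` and `R`. A member
inside `U` cannot lie in `closure P`, by the choice of `W`, nor in `closure R`, by minimality. -/
theorem exists_splits_below {X : Type*} [TopologicalSpace X] [CompactSpace X] [T2Space X]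
    (𝒰 : Set (Set X)) (h𝒰 : ∀ U ∈ 𝒰, IsOpen U ∧ U.Nonempty) (hne : 𝒰.Nonempty)
    (h : ∀ x : X, ∃ W, IsOpen W ∧ x ∈ W ∧ ∀ V ∈ 𝒰, ¬ V ⊆ W) :
    ∃ U ∈ 𝒰, ∃ G, Splits {V ∈ 𝒰 | V ⊆ U} G := by
  classical
  let Q : ℕ → Prop := fun k => ∃ U ∈ 𝒰, ∃ t : Finset (Set X), t.card = k ∧
    (∀ W ∈ t, IsOpen W ∧ ∀ V ∈ 𝒰, ¬ V ⊆ W) ∧ closure U ⊆ ⋃₀ (t : Set (Set X))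
  have hQ : ∃ k, Q k := by
    choose W hWo hxW hW using h
    obtain ⟨s, hs⟩ := isCompact_univ.elim_finite_subcover W hWo
      fun x _ => mem_iUnion.2 ⟨x, hxW x⟩
    obtain ⟨U, hU⟩ := hne
    refine ⟨_, U, hU, s.image W, rfl, ?_, ?_⟩
    · intro V hV
      obtain ⟨x, -, rfl⟩ := Finset.mem_image.1 hV
      exact ⟨hWo x, hW x⟩
    · intro x _
      obtain ⟨i, hi, hx⟩ := mem_iUnion₂.1 (hs (mem_univ x))
      exact ⟨W i, by simpa using ⟨i, hi, rfl⟩, hx⟩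
  obtain ⟨U, hU, t, htc, ht, hUt⟩ := Nat.find_spec hQ
  have hmin : ∀ V ∈ 𝒰, ∀ t' ⊂ t, ¬ closure V ⊆ ⋃₀ (t' : Set (Set X)) := fun V hV t' ht' hcl =>
    Nat.find_min hQ (htc ▸ Finset.card_lt_card ht') ⟨V, hV, t', rfl, fun W hW => ht W (ht'.1 hW), hcl⟩
  have htne : t.Nonempty := by
    rw [Finset.nonempty_iff_ne_empty]
    rintro rfl
    obtain ⟨x, hx⟩ := (h𝒰 U hU).2
    simpa using hUt (subset_closure hx)
  obtain ⟨W, hW⟩ := htne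
  have hsub : closure U ⊆ W ∪ ⋃₀ (t.erase W : Set (Set X)) := by
    intro x hx
    obtain ⟨V, hV, hxV⟩ := hUt hx
    by_cases hVW : V = W
    · exact Or.inl (hVW ▸ hxV)
    · exact Or.inr ⟨V, by simpa using ⟨hV, hVW⟩, hxV⟩
  have hWo := (ht W hW).1
  have hto : IsOpen (⋃₀ (t.erase W : Set (Set X))) :=
    isOpen_sUnion fun V hV => (ht V (Finset.mem_of_mem_erase hV)).1
  obtain ⟨K₁, K₂, hK₁, hK₂, hK₁W, hK₂t, hK⟩ :=
    isClosed_closure.isCompact.binary_compact_cover hWo hto hsub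
  obtain ⟨P, hPo, hKP, hPW⟩ := normal_exists_closure_subset hK₁.isClosed hWo hK₁W
  obtain ⟨R, hRo, hKR, hRt⟩ := normal_exists_closure_subset hK₂.isClosed hto hK₂t
  have hUo := (h𝒰 U hU).1
  have hcl : ∀ S : Set X, IsOpen S → closure (U \ closure S) ⊆ closure U \ S := by
    intro S hS
    refine closure_minimal ?_ (isClosed_closure.sdiff hS)
    exact fun x hx => ⟨subset_closure hx.1, fun hxS => hx.2 (subset_closure hxS)⟩
  refine ⟨U, hU, fun b => bif b then U \ closure P else U \ closure R, ?_, ?_, ?_⟩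
  · rintro (_ | _)
    · exact hUo.sdiff isClosed_closure
    · exact hUo.sdiff isClosed_closure
  · rw [Set.disjoint_left]
    intro x hxf hxt
    have h1 := hcl R hRo hxf
    have h2 := hcl P hPo hxt
    rcases hK.subset h1.1 with h3 | h3
    · exact h2.2 (hKP h3)
    · exact h1.2 (hKR h3)
  · rintro V ⟨hV, hVU⟩ (_ | _)
    · by_contra hemp
      refine hmin V hV _ (Finset.erase_ssubset hW) ?_
      refine (closure_minimal (fun x hx => ?_) isClosed_closure).trans hRt
      by_contra hxR
      exact hemp ⟨x, hx, hVU hx, hxR⟩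
    · by_contra hemp
      refine (ht W hW).2 V hV (Subset.trans (fun x hx => ?_) hPW)
      by_contra hxP
      exact hemp ⟨x, hx, hVU hx, hxP⟩

/-- If no point has a countable local `π`-base, then some nonempty open set `U` is such that every
countable family of nonempty open subsets of `U` is split. -/
theorem exists_open_forall_countable_splits {X : Type*} [TopologicalSpace X] [CompactSpace X]
    [T2Space X] [Nonempty X] (h : ∀ x : X, ¬ HasCountablePiBaseAt x) :
    ∃ U : Set X, IsOpen U ∧ U.Nonempty ∧ ∀ 𝒱 : Set (Set X), 𝒱.Countable →
      (∀ V ∈ 𝒱, IsOpen V ∧ V.Nonempty ∧ V ⊆ U) → ∃ G, Splits 𝒱 G := by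
  by_contra! hcon
  have hstep : ∀ U : Set X, ∃ g : ℕ → Set X, IsOpen U ∧ U.Nonempty →
      (∀ n, IsOpen (g n) ∧ (g n).Nonempty ∧ g n ⊆ U) ∧ ∀ G, ¬ Splits (range g) G := by
    intro U
    by_cases hU : IsOpen U ∧ U.Nonempty
    · obtain ⟨𝒱, hc, h𝒱, hG⟩ := hcon U hU.1 hU.2
      have hne : 𝒱.Nonempty := by
        rw [Set.nonempty_iff_ne_empty]
        rintro rfl
        exact hG (fun _ => ∅) ⟨by simp, by simp, by simp⟩
      obtain ⟨g, rfl⟩ := hc.exists_eq_range hne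
      exact ⟨g, fun _ => ⟨fun n => h𝒱 _ (mem_range_self n), hG⟩⟩
    · exact ⟨fun _ => U, fun h => absurd h hU⟩
  choose g hg using hstep
  -- A countable tree of open sets in which the children of each node form an unsplit family inside
  -- it.
  let E : List ℕ → Set X := fun l => l.rec univ fun n _ U => g U n
  have hE : ∀ l, IsOpen (E l) ∧ (E l).Nonempty := by
    intro l
    induction l with
    | nil => exact ⟨isOpen_univ, univ_nonempty⟩
    | cons n l ih => exact ⟨((hg _ ih).1 n).1, ((hg _ ih).1 n).2.1⟩
  obtain ⟨U, ⟨l, rfl⟩, G, hG⟩ := exists_splits_below (range E) (by rintro _ ⟨l, rfl⟩; exact hE l)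
    (range_nonempty E) (by
      intro x
      by_contra! hx
      refine h x ?_
      obtain ⟨e, he⟩ := (countable_range E).exists_eq_range (range_nonempty E)
      refine ⟨e, fun i => ?_, fun O hO hxO => ?_⟩
      · obtain ⟨l, hl⟩ := he.symm.subset (mem_range_self i)
        exact hl ▸ hE l
      · obtain ⟨V, hV, hVO⟩ := hx O hO hxO
        obtain ⟨i, rfl⟩ := he.subset hV
        exact ⟨i, hVO⟩)
  refine (hg _ (hE l)).2 G ⟨hG.1, hG.2.1, ?_⟩
  rintro _ ⟨n, rfl⟩
  exact hG.2.2 _ ⟨⟨n :: l, rfl⟩, ((hg _ (hE l)).1 n).2.2⟩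

/-- If no point has a countable local `π`-base, then there are `ω₁` independent pairs of disjoint
closed sets. -/
theorem dyadic_univ_of_not_hasCountablePiBaseAt {X : Type*} [TopologicalSpace X] [CompactSpace X]
    [T2Space X] [Nonempty X] (h : ∀ x : X, ¬ HasCountablePiBaseAt x)
    {I : Type*} [LinearOrder I] [WellFoundedLT I] (hI : ∀ a : I, (Iio a).Countable) :
    DyadicOn I (univ : Set X) := by
  classical
  obtain ⟨U, hUo, hUne, hU⟩ := exists_open_forall_countable_splits h
  let fam : Set (Bool → Set X) → Set (Set X) := fun 𝒬 =>
    {V | V.Nonempty ∧ IsOpen V ∧ ∃ t : Finset ((Bool → Set X) × Bool),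
      (t : Set ((Bool → Set X) × Bool)) ⊆ 𝒬 ×ˢ univ ∧ V = U ∩ ⋂ p ∈ t, p.1 p.2}
  have hfam : ∀ 𝒬 : Set (Bool → Set X), 𝒬.Countable → (fam 𝒬).Countable := by
    intro 𝒬 h𝒬
    have hc : {t : Finset ((Bool → Set X) × Bool) |
        (t : Set ((Bool → Set X) × Bool)) ⊆ 𝒬 ×ˢ univ}.Countable := by
      have := Set.countable_ofPred_finite_subset (h𝒬.prod (countable_univ (α := Bool)))
      refine (this.preimage_of_injOn (f := fun t : Finset ((Bool → Set X) × Bool) => (t : Set _))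
        Finset.coe_injective.injOn).mono ?_
      exact fun t ht => ⟨t.finite_toSet, ht⟩
    refine (hc.image fun t => U ∩ ⋂ p ∈ t, p.1 p.2).mono ?_
    rintro V ⟨-, -, t, ht, rfl⟩
    exact ⟨t, ht, rfl⟩
  obtain ⟨G, hG⟩ := exists_wellFounded_choice (I := I) (fun 𝒬 G => Splits (fam 𝒬) G)
  have hG' : ∀ a, Splits (fam (G '' Iio a)) (G a) := fun a => hG a <|
    hU _ (hfam _ ((hI a).image G)) fun V ⟨hV, hVo, t, ht, hVt⟩ =>
      ⟨hVo, hV, hVt ▸ inter_subset_left⟩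
  have hfin : ∀ (g : I → Bool) (J : Finset I), (U ∩ ⋂ i ∈ J, G i (g i)).Nonempty := by
    intro g J
    induction J using Finset.induction_on_max with
    | empty => simpa using hUne
    | insert a s hs ih =>
      have hmem : (U ∩ ⋂ i ∈ s, G i (g i)) ∈ fam (G '' Iio a) := by
        refine ⟨ih, hUo.inter (isOpen_biInter_finset fun i _ => (hG' i).1 _),
          s.image fun i => (G i, g i), ?_, ?_⟩
        · intro p hp
          obtain ⟨i, hi, rfl⟩ := Finset.mem_image.1 (Finset.mem_coe.1 hp)
          exact ⟨⟨i, hs i hi, rfl⟩, mem_univ _⟩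
        · rw [Finset.set_biInter_finset_image]
      obtain ⟨x, hx, hxa⟩ := (hG' a).2.2 _ hmem (g a)
      refine ⟨x, hx.1, ?_⟩
      rw [Finset.set_biInter_insert]
      exact ⟨hxa, hx.2⟩
  refine ⟨fun i b => closure (G i b), fun _ _ => isClosed_closure, fun i => (hG' i).2.1, fun g => ?_⟩
  refine inter_iInter_nonempty_of_finite isClosed_univ _ (fun _ => isClosed_closure) fun J => ?_
  exact (hfin g J).mono (inter_subset_inter (subset_univ _)
    (iInter₂_mono fun i _ => subset_closure))

/-! ### Countable tightness against independent pairs -/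

/-- If a hereditary choice among nonempty closed sets of a compact space covered by countably many
sets `A n` is given, then some `A n` meets all chosen subsets of some chosen set. -/
theorem exists_forall_subset_inter_nonempty {X : Type*} [TopologicalSpace X] [CompactSpace X]
    {A : ℕ → Set X} (hA : ⋃ n, A n = univ) (P : Set X → Prop)
    (hP : ∀ F, P F → IsClosed F ∧ F.Nonempty) (hex : ∃ F, P F) :
    ∃ F n, P F ∧ ∀ F' ⊆ F, P F' → (A n ∩ F').Nonempty := by
  by_contra! hcon
  choose! next hsub hnext hdisj using hcon
  obtain ⟨F₀, hF₀⟩ := hex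
  let s : ℕ → Set X := fun n => n.rec F₀ fun k F => next F k
  have hs : ∀ n, P (s n) := by
    intro n
    induction n with
    | zero => exact hF₀
    | succ k ih => exact hnext _ k ih
  obtain ⟨x, hx⟩ := IsCompact.nonempty_iInter_of_sequence_nonempty_isCompact_isClosed s
    (fun n => hsub _ n (hs n)) (fun n => (hP _ (hs n)).2) (hP _ (hs 0)).1.isCompact
    (fun n => (hP _ (hs n)).1)
  obtain ⟨n, hn⟩ := mem_iUnion.1 (hA.symm.subset (mem_univ x))
  exact (hdisj (s n) n (hs n)).subset ⟨hn, mem_iInter.1 hx (n + 1)⟩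

theorem not_dyadicOn_of_countablyTight_cover {X : Type*} [TopologicalSpace X] [CompactSpace X]
    {A : ℕ → Set X} (hA : ⋃ n, A n = univ)
    (htight : ∀ n, ∀ Z ⊆ A n, ∀ y ∈ A n, y ∈ closure Z →
      ∃ C ⊆ Z, C.Countable ∧ y ∈ closure C)
    {I : Type*} [LinearOrder I]
    (hI : ∀ S : Set I, S.Countable → ∃ c, ∀ a ∈ S, a < c) (e : I ⊕ I ⊕ I ≃ I)
    {F : Set X} (hFc : IsClosed F) : ¬ DyadicOn I F := by
  classical
  intro hF
  obtain ⟨F, n, ⟨hFc, B, hBc, hBd, hB⟩, hmeet⟩ := exists_forall_subset_inter_nonempty hA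
    (fun F => IsClosed F ∧ DyadicOn I F) (fun F h => ⟨h.1, h.2.nonempty⟩) ⟨F, hFc, hF⟩
  -- Three blocks of pairs: `a` carries an `ω₁`-sequence pattern, `b` keeps the limit set dyadic,
  -- and `c` keeps dyadic the sets from which the points are chosen.
  let a : I → Bool → Set X := fun i => B (e (.inl i))
  let b : I → Bool → Set X := fun i => B (e (.inr (.inl i)))
  let c : I → Bool → Set X := fun i => B (e (.inr (.inr i)))
  have hbranch : ∀ ga gb gc : I → Bool, (F ∩ (⋂ i, a i (ga i)) ∩ (⋂ i, b i (gb i)) ∩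
      ⋂ i, c i (gc i)).Nonempty := by
    intro ga gb gc
    obtain ⟨x, hxF, hx⟩ := hB (fun i => Sum.elim ga (Sum.elim gb gc) (e.symm i))
    rw [mem_iInter] at hx
    refine ⟨x, ⟨⟨hxF, mem_iInter.2 fun i => ?_⟩, mem_iInter.2 fun i => ?_⟩,
      mem_iInter.2 fun i => ?_⟩
    · simpa using hx (e (.inl i))
    · simpa using hx (e (.inr (.inl i)))
    · simpa using hx (e (.inr (.inr i)))
  have hpt : ∀ (i : I) (g : I → Bool), ∃ x ∈ A n, x ∈ F ∧ (∀ j, x ∈ a j (decide (j < i))) ∧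
      ∀ j, x ∈ b j (g j) := by
    intro i g
    obtain ⟨x, hxA, hx⟩ := hmeet
      (F ∩ (⋂ j, a j (decide (j < i))) ∩ (⋂ j, b j (g j))) (fun x hx => hx.1.1)
      ⟨(hFc.inter (isClosed_iInter fun j => hBc _ _)).inter (isClosed_iInter fun j => hBc _ _),
        c, fun _ _ => hBc _ _, fun _ => hBd _, fun gc => hbranch _ _ gc⟩
    exact ⟨x, hxA, hx.1.1, mem_iInter.1 hx.1.2, mem_iInter.1 hx.2⟩
  choose x hxA hxF hxa hxb using hpt
  let Z : Set X := range fun p : I × (I → Bool) => x p.1 p.2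
  have hZA : Z ⊆ A n := by
    rintro _ ⟨p, rfl⟩
    exact hxA _ _
  obtain ⟨y, hyA, hy⟩ := hmeet ((F ∩ closure Z) ∩ ⋂ j, a j true) (fun x hx => hx.1.1) <| by
    have hcl : IsClosed ((F ∩ closure Z) ∩ ⋂ j, a j true) :=
      (hFc.inter isClosed_closure).inter (isClosed_iInter fun j => hBc _ _)
    refine ⟨hcl, b, fun _ _ => hBc _ _, fun _ => hBd _, fun g => ?_⟩
    have hclosed : IsClosed ((F ∩ closure Z) ∩ ⋂ j, b j (g j)) :=
      (hFc.inter isClosed_closure).inter (isClosed_iInter fun j => hBc _ _)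
    refine (inter_iInter_nonempty_of_finite hclosed (fun j => a j true) (fun j => hBc _ _)
      fun J => ?_).mono fun z hz => ⟨⟨hz.1.1, hz.2⟩, hz.1.2⟩
    -- An index above the finite set `J` gives a point whose `a`-pattern is `true` on all of `J`.
    obtain ⟨i, hi⟩ := hI J J.countable_toSet
    refine ⟨x i g, ⟨⟨hxF _ _, subset_closure ⟨(i, g), rfl⟩⟩, mem_iInter.2 (hxb i g)⟩,
      mem_iInter₂.2 fun j hj => ?_⟩
    simpa [hi j hj] using hxa i g j
  obtain ⟨C, hCZ, hC, hyC⟩ := htight n Z hZA y hyA hy.1.2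
  obtain ⟨i₀, -⟩ := hI ∅ countable_empty
  have : Nonempty (I × (I → Bool)) := ⟨(i₀, fun _ => true)⟩
  choose! p hp using fun z (hz : z ∈ C) => hCZ hz
  -- The countably many indices are bounded by `i`, so `C` lies on the `false` side at `i`, while
  -- `y` lies on the `true` side.
  obtain ⟨i, hi⟩ := hI _ (hC.image fun z => (p z).1)
  have hCa : C ⊆ a i false := by
    intro z hz
    have h1 := hxa (p z).1 (p z).2 i
    have h2 : x (p z).1 (p z).2 = z := hp z hz
    rwa [h2, decide_eq_false (hi _ (mem_image_of_mem _ hz)).not_gt] at h1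
  exact Set.disjoint_left.1 (hBd _) (closure_minimal hCa (hBc _ _) hyC) (mem_iInter.1 hy.2 i)

theorem exists_hasCountablePiBaseAt {X : Type*} [TopologicalSpace X] [CompactSpace X] [T2Space X]
    [Nonempty X] {A : ℕ → Set X} (hA : ⋃ n, A n = univ)
    (htight : ∀ n, ∀ Z ⊆ A n, ∀ y ∈ A n, y ∈ closure Z →
      ∃ C ⊆ Z, C.Countable ∧ y ∈ closure C) : ∃ x : X, HasCountablePiBaseAt x := by
  by_contra! h
  obtain ⟨I, _, _, hI, hI', ⟨e⟩⟩ := exists_omega_one_order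
  exact not_dyadicOn_of_countablyTight_cover hA htight hI' e isClosed_univ
    (dyadic_univ_of_not_hasCountablePiBaseAt h hI)

/-! ### `G_δ` sets inside closures of countable sets -/

theorem HasCountablePiBaseAt.homeomorph {X : Type*} [TopologicalSpace X] {x : X}
    (hx : HasCountablePiBaseAt x) (h : X ≃ₜ X) : HasCountablePiBaseAt (h x) := by
  obtain ⟨V, hV, hVx⟩ := hx
  refine ⟨fun i => h '' V i, fun i => ⟨h.isOpenMap _ (hV i).1, (hV i).2.image h⟩,
    fun O hO hxO => ?_⟩
  obtain ⟨i, hi⟩ := hVx (h ⁻¹' O) (hO.preimage h.continuous) hxO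
  exact ⟨i, image_subset_iff.2 hi⟩

theorem HasCountablePiBaseAt.exists_seq_mem_closure {X : Type*} [TopologicalSpace X] {x : X}
    (hx : HasCountablePiBaseAt x) {A : Set X} (hA : Dense A) :
    ∃ s : ℕ → X, (∀ k, s k ∈ A) ∧ x ∈ closure (range s) := by
  obtain ⟨V, hV, hVx⟩ := hx
  choose s hsV hsA using fun i => hA.inter_open_nonempty (V i) (hV i).1 (hV i).2
  refine ⟨s, hsA, mem_closure_iff.2 fun O hO hxO => ?_⟩
  obtain ⟨i, hi⟩ := hVx O hO hxO
  exact ⟨s i, hi (hsV i), mem_range_self i⟩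

/-- Every point off a closed set of a normal space lies in a closed `G_δ` set missing it. -/
theorem exists_isClosed_isGδ_disjoint {X : Type*} [TopologicalSpace X] [NormalSpace X] [T1Space X]
    {x : X} {E : Set X} (hE : IsClosed E) (hx : x ∉ E) :
    ∃ T : Set X, IsClosed T ∧ IsGδ T ∧ x ∈ T ∧ Disjoint T E := by
  obtain ⟨f, hf0, hf1, -⟩ := exists_continuous_zero_one_of_isClosed (isClosed_singleton (x := x)) hE
    (disjoint_singleton_left.2 hx)
  refine ⟨f ⁻¹' {0}, isClosed_singleton.preimage f.continuous,
    (isClosed_singleton (x := (0 : ℝ))).isGδ.preimage f.continuous, hf0 rfl, ?_⟩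
  rw [Set.disjoint_left]
  intro z hz hzE
  have h1 : f z = 0 := hz
  have h2 : f z = 1 := hf1 hzE
  rw [h1] at h2
  exact zero_ne_one h2

/-- Otherwise recursion of length `ω₁` gives points in decreasing closed `G_δ` sets, each set
missing the closure of the sequences attached to earlier points. A point `y` in the closure of every
tail lies in all these sets, yet countable tightness of the piece containing `y` puts it in the
closure of sequences from an initial segment. -/
theorem exists_isGδ_subset_closure_countable {X : Type*} [TopologicalSpace X] [CompactSpace X]
    [T2Space X] [Nonempty X] {A : ℕ → Set X} (hA : ⋃ n, A n = univ)
    (htight : ∀ n, ∀ Z ⊆ A n, ∀ y ∈ A n, y ∈ closure Z →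
      ∃ C ⊆ Z, C.Countable ∧ y ∈ closure C)
    (σ : X → ℕ → ℕ → X) (hσA : ∀ x n k, σ x n k ∈ A n)
    (hσ : ∀ x n, x ∈ closure (range (σ x n))) :
    ∃ K S : Set X, IsClosed K ∧ IsGδ K ∧ K.Nonempty ∧ S.Countable ∧ K ⊆ closure S := by
  classical
  by_contra! hcon
  obtain ⟨I, _, _, hI, hI', -⟩ := exists_omega_one_order
  let N : Set (X × Set X) → Set X := fun 𝒬 => ⋃ p ∈ 𝒬, ⋃ n, range (σ p.1 n)
  obtain ⟨f, hf⟩ := exists_wellFounded_choice (I := I) (Y := X × Set X) (fun 𝒬 q =>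
    IsClosed q.2 ∧ IsGδ q.2 ∧ q.1 ∈ q.2 ∧ Disjoint q.2 (closure (N 𝒬)) ∧ ∀ p ∈ 𝒬, q.2 ⊆ p.2)
  have key : ∀ i, IsClosed (f i).2 ∧ IsGδ (f i).2 ∧ (f i).1 ∈ (f i).2 ∧
      Disjoint (f i).2 (closure (N (f '' Iio i))) ∧ ∀ p ∈ f '' Iio i, (f i).2 ⊆ p.2 := by
    intro i
    induction i using WellFoundedLT.induction with
    | ind i ih =>
    refine hf i ?_
    have hanti : ∀ j < i, ∀ l ≤ j, (f j).2 ⊆ (f l).2 := by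
      intro j hj l hl
      rcases hl.eq_or_lt with rfl | hl
      · exact subset_rfl
      · exact (ih j hj).2.2.2.2 _ ⟨l, hl, rfl⟩
    have hKc : IsClosed (⋂ j ∈ Iio i, (f j).2) := isClosed_biInter fun j hj => (ih j hj).1
    have hKG : IsGδ (⋂ j ∈ Iio i, (f j).2) := IsGδ.biInter (hI i) fun j hj => (ih j hj).2.1
    have hKne : (⋂ j ∈ Iio i, (f j).2).Nonempty := by
      have := inter_iInter_nonempty_of_finite (isClosed_univ (X := X))
        (fun j : Iio i => (f j).2) (fun j => (ih j j.2).1) (fun J => by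
          rcases J.eq_empty_or_nonempty with rfl | hJ
          · simp
          · refine ⟨(f (J.max' hJ)).1, mem_univ _, mem_iInter₂.2 fun j hj => ?_⟩
            exact hanti _ (J.max' hJ).2 _ (J.le_max' j hj) (ih _ (J.max' hJ).2).2.2.1)
      rw [univ_inter, iInter_subtype] at this
      exact this
    have hN : (N (f '' Iio i)).Countable :=
      ((hI i).image f).biUnion fun p _ => countable_iUnion fun n => countable_range _
    obtain ⟨x, hxK, hx⟩ := Set.not_subset.1 (hcon _ _ hKc hKG hKne hN)
    obtain ⟨T, hTc, hTG, hxT, hTd⟩ := exists_isClosed_isGδ_disjoint isClosed_closure hx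
    refine ⟨(x, (⋂ j ∈ Iio i, (f j).2) ∩ T), hKc.inter hTc, hKG.inter hTG, ⟨hxK, hxT⟩,
      hTd.mono_left inter_subset_right, ?_⟩
    rintro _ ⟨j, hj, rfl⟩
    exact inter_subset_left.trans (biInter_subset_of_mem hj)
  have hmem : ∀ i j, i ≤ j → (f j).1 ∈ (f i).2 := by
    intro i j hij
    rcases hij.eq_or_lt with rfl | hij
    · exact (key i).2.2.1
    · exact (key j).2.2.2.2 _ ⟨i, hij, rfl⟩ (key j).2.2.1
  obtain ⟨y, -, hy⟩ := inter_iInter_nonempty_of_finite (isClosed_univ (X := X))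
    (fun i : I => closure ((fun j => (f j).1) '' Ici i)) (fun _ => isClosed_closure) (fun J => by
      obtain ⟨c, hc⟩ := hI' J J.countable_toSet
      exact ⟨(f c).1, mem_univ _, mem_iInter₂.2 fun i hi =>
        subset_closure ⟨c, (hc i hi).le, rfl⟩⟩)
  rw [mem_iInter] at hy
  have hyT : ∀ i, y ∈ (f i).2 := fun i => closure_minimal
    (by rintro _ ⟨j, hj, rfl⟩; exact hmem i j hj) (key i).1 (hy i)
  obtain ⟨n, hn⟩ := mem_iUnion.1 (hA.symm.subset (mem_univ y))
  let Z : Set X := ⋃ i, range (σ (f i).1 n)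
  have hZA : Z ⊆ A n := iUnion_subset fun i => by
    rintro _ ⟨k, rfl⟩
    exact hσA _ _ _
  obtain ⟨i₀, -⟩ := hI' ∅ countable_empty
  have hyZ : y ∈ closure Z := closure_minimal (by
    rintro _ ⟨j, -, rfl⟩
    exact closure_mono (subset_iUnion (fun i => range (σ (f i).1 n)) j) (hσ _ n))
    isClosed_closure (hy i₀)
  obtain ⟨C, hCZ, hC, hyC⟩ := htight n Z hZA y hn hyZ
  have : Nonempty I := ⟨i₀⟩
  choose! p hp using fun z (hz : z ∈ C) => mem_iUnion.1 (hCZ hz)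
  obtain ⟨i, hi⟩ := hI' _ (hC.image p)
  have hCN : C ⊆ N (f '' Iio i) := fun z hz =>
    mem_biUnion ⟨p z, hi _ (mem_image_of_mem _ hz), rfl⟩ (mem_iUnion.2 ⟨n, hp z hz⟩)
  exact Set.disjoint_left.1 (key i).2.2.2.1 (hyT i) (closure_mono hCN hyC)

/-! ### Separating families of open sets -/

theorem exists_closure_image_subset {X : Type*} [TopologicalSpace X] [RegularSpace X]
    {c : ℕ → X} {y : X} (hy : y ∈ closure (range c)) {O : Set X} (hO : IsOpen O) (hyO : y ∈ O) :
    ∃ P : Set ℕ, y ∈ closure (c '' P) ∧ closure (c '' P) ⊆ O := by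
  obtain ⟨W, hyW, hWo, hWO⟩ := exists_mem_nhds_isClosed_subset (hO.mem_nhds hyO)
  refine ⟨c ⁻¹' W, mem_closure_iff.2 fun V hV hyV => ?_,
    (closure_minimal (image_preimage_subset c W) hWo).trans hWO⟩
  obtain ⟨z, ⟨hzV, hzW⟩, k, rfl⟩ := mem_closure_iff.1 hy (V ∩ interior W)
    (hV.inter isOpen_interior) ⟨hyV, mem_interior_iff_mem_nhds.2 hyW⟩
  exact ⟨c k, hzV, k, interior_subset (s := W) hzW, rfl⟩

/-- A `G_δ` set contained in the closure of a sequence has a family of open sets of size at most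
continuum which separates its points from all other points. -/
theorem exists_separating_of_isGδ {X : Type*} [TopologicalSpace X] [CompactSpace X] [T2Space X]
    {K : Set X} (hK : IsGδ K) {s : ℕ → X} (hs : K ⊆ closure (range s)) :
    ∃ B : ℕ ⊕ Set ℕ × Set ℕ → Set X, (∀ r, IsOpen (B r)) ∧
      ∀ y ∈ K, ∀ z, z ≠ y → ∃ r, y ∈ B r ∧ z ∉ B r := by
  obtain ⟨O, hO, rfl⟩ := isGδ_iff_eq_iInter_nat.1 hK
  have hsep : ∀ p : Set ℕ × Set ℕ, ∃ V : Set X, IsOpen V ∧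
      (Disjoint (closure (s '' p.1)) (closure (s '' p.2)) →
        closure (s '' p.1) ⊆ V ∧ Disjoint V (closure (s '' p.2))) := by
    intro p
    by_cases hp : Disjoint (closure (s '' p.1)) (closure (s '' p.2))
    · obtain ⟨V, W, hV, hW, h1, h2, h3⟩ := normal_separation isClosed_closure isClosed_closure hp
      exact ⟨V, hV, fun _ => ⟨h1, h3.mono_right h2⟩⟩
    · exact ⟨∅, isOpen_empty, fun h => absurd h hp⟩
  choose V hVo hV using hsep
  refine ⟨Sum.elim O V, ?_, fun y hy z hzy => ?_⟩
  · rintro (n | p)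
    · exact hO n
    · exact hVo p
  by_cases hz : z ∈ ⋂ n, O n
  · obtain ⟨W₁, W₂, hW₁, hW₂, hyW, hzW, hW⟩ := t2_separation hzy.symm
    obtain ⟨P₁, hyP, hP₁⟩ := exists_closure_image_subset (hs hy) hW₁ hyW
    obtain ⟨P₂, hzP, hP₂⟩ := exists_closure_image_subset (hs hz) hW₂ hzW
    have h := hV (P₁, P₂) (hW.mono hP₁ hP₂)
    exact ⟨Sum.inr (P₁, P₂), h.1 hyP, fun hz' => Set.disjoint_left.1 h.2 hz' hzP⟩
  · obtain ⟨n, hn⟩ : ∃ n, z ∉ O n := by simpa using hz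
    exact ⟨Sum.inl n, mem_iInter.1 hy n, hn⟩

/-- Around a point of `closure (range c)`, a `G_δ` set can be shrunk to `⋂ n, closure (c '' p n)`.
Only `𝔠` many `p` exist, and one separating family is fixed for each. -/
theorem exists_separating_of_seq {X : Type*} [TopologicalSpace X] [CompactSpace X] [T2Space X]
    (hK : ∀ x : X, ∃ K : Set X, ∃ s : ℕ → X, IsGδ K ∧ x ∈ K ∧ K ⊆ closure (range s))
    (c : ℕ → X) :
    ∃ B : (ℕ → Set ℕ) × (ℕ ⊕ Set ℕ × Set ℕ) → Set X, (∀ r, IsOpen (B r)) ∧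
      ∀ y ∈ closure (range c), ∀ z, z ≠ y → ∃ r, y ∈ B r ∧ z ∉ B r := by
  have h : ∀ p : ℕ → Set ℕ, ∃ B : ℕ ⊕ Set ℕ × Set ℕ → Set X, (∀ r, IsOpen (B r)) ∧
      ((∃ K : Set X, ∃ s : ℕ → X, IsGδ K ∧ K ⊆ closure (range s) ∧
        ⋂ n, closure (c '' p n) ⊆ K) →
      ∀ y ∈ ⋂ n, closure (c '' p n), ∀ z, z ≠ y → ∃ r, y ∈ B r ∧ z ∉ B r) := by
    intro p
    by_cases hp : ∃ K : Set X, ∃ s : ℕ → X, IsGδ K ∧ K ⊆ closure (range s) ∧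
        ⋂ n, closure (c '' p n) ⊆ K
    · obtain ⟨K, s, hKG, hKs, hpK⟩ := hp
      obtain ⟨B, hB, hB'⟩ := exists_separating_of_isGδ hKG hKs
      exact ⟨B, hB, fun _ y hy => hB' y (hpK hy)⟩
    · exact ⟨fun _ => ∅, fun _ => isOpen_empty, fun h => absurd h hp⟩
  choose B hBo hB using h
  refine ⟨fun r => B r.1 r.2, fun r => hBo _ _, fun y hy z hzy => ?_⟩
  obtain ⟨K, s, hKG, hyK, hKs⟩ := hK y
  obtain ⟨O, hO, rfl⟩ := isGδ_iff_eq_iInter_nat.1 hKG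
  choose p hyp hpO using fun n => exists_closure_image_subset hy (hO n) (mem_iInter.1 hyK n)
  obtain ⟨r, hr⟩ := hB p ⟨_, s, hKG, hKs, iInter_mono hpO⟩ y (mem_iInter.2 hyp) z hzy
  exact ⟨(p, r), hr⟩

/-! ### Closing off to a dense set of size continuum -/

/-- Closing off under continuum many operations of countable arity yields a set of size at most
continuum. -/
theorem exists_closed_under_mk_le_continuum {X : Type u} {P : Type} (hP : #P ≤ 𝔠) (x₀ : X)
    (F : P → (ℕ → ℕ → X) → X) :
    ∃ D : Set X, x₀ ∈ D ∧ #D ≤ 𝔠 ∧ ∀ p s, (∀ i j, s i j ∈ D) → F p s ∈ D := by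
  -- Well-founded terms with one constant, for `x₀`, and one operation of arity `ℕ × ℕ` for each
  -- `p`.
  let β : Option P → Type := fun o => o.elim Empty fun _ => ℕ × ℕ
  let ev : WType β → X := WType.elim X fun ⟨a, g⟩ => match a, g with
    | none, _ => x₀
    | some p, g => F p fun i j => g (i, j)
  have hW : #(WType β) ≤ 𝔠 := by
    refine WType.cardinalMk_le_of_le ?_
    calc Cardinal.sum (fun a : Option P => 𝔠 ^ #(β a))
        ≤ Cardinal.sum (fun _ : Option P => 𝔠) := by
          refine Cardinal.sum_le_sum _ _ fun a => ?_
          rcases a with _ | p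
          · simpa [β] using Cardinal.one_le_aleph0.trans Cardinal.aleph0_le_continuum
          · simp [β]
      _ = #(Option P) * 𝔠 := by simp
      _ ≤ 𝔠 * 𝔠 := by
          gcongr
          rw [Cardinal.mk_option]
          exact Cardinal.add_le_of_le Cardinal.aleph0_le_continuum hP
            (Cardinal.one_le_aleph0.trans Cardinal.aleph0_le_continuum)
      _ = 𝔠 := Cardinal.continuum_mul_self
  refine ⟨range ev, ⟨.mk none Empty.elim, rfl⟩, ?_, ?_⟩
  · have h := Cardinal.mk_range_le_lift (f := ev)
    have h2 : Cardinal.lift.{u} #(WType β) ≤ 𝔠 := by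
      rw [← Cardinal.lift_continuum.{u, 0}]
      exact Cardinal.lift_le.2 hW
    simpa using h.trans h2
  · intro p s hs
    choose w hw using hs
    refine ⟨.mk (some p) fun q : ℕ × ℕ => w q.1 q.2, ?_⟩
    change F p (fun i j => ev (w i j)) = F p s
    simp only [hw]

theorem mk_separating_index_le :
    #(ℕ → (ℕ → Set ℕ) × (ℕ ⊕ Set ℕ × Set ℕ)) ≤ 𝔠 := by
  have h1 : #(Set ℕ) = 𝔠 := by simp
  simp [h1]

/-- If `z ∉ closure D`, tightness places each point of `closure D` in the closure of a sequence
coded by points of `D`, so a coded open set contains it and misses `z`. Finitely many of these cover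
`closure D`, but `D` was closed off to contain a point outside any such union that is not all of
`X`. -/
theorem exists_dense_mk_le_continuum {X : Type u} [TopologicalSpace X] [CompactSpace X] [T2Space X]
    [Nonempty X] {A : ℕ → Set X} (hA : ⋃ n, A n = univ)
    (htight : ∀ n, ∀ Z ⊆ A n, ∀ y ∈ A n, y ∈ closure Z →
      ∃ C ⊆ Z, C.Countable ∧ y ∈ closure C)
    (σ : X → ℕ → ℕ → X) (hσA : ∀ x n k, σ x n k ∈ A n)
    (hσ : ∀ x n, x ∈ closure (range (σ x n)))
    (hK : ∀ x : X, ∃ K : Set X, ∃ s : ℕ → X, IsGδ K ∧ x ∈ K ∧ K ⊆ closure (range s)) :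
    ∃ D : Set X, Dense D ∧ #D ≤ 𝔠 := by
  classical
  choose B hBo hB using exists_separating_of_seq hK
  let N : (ℕ → X) → ℕ → X := fun s j => σ (s j.unpair.1) j.unpair.2.unpair.1 j.unpair.2.unpair.2
  have hN : ∀ s i n k, σ (s i) n k ∈ range (N s) := fun s i n k =>
    ⟨Nat.pair i (Nat.pair n k), by simp [N]⟩
  let x₀ : X := Classical.arbitrary X
  have hF : ∀ (r : ℕ → (ℕ → Set ℕ) × (ℕ ⊕ Set ℕ × Set ℕ)) (s : ℕ → ℕ → X), ∃ x : X,
      (∃ z, z ∉ ⋃ i, B (N (s i)) (r i)) → x ∉ ⋃ i, B (N (s i)) (r i) := by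
    intro r s
    by_cases h : ∃ z, z ∉ ⋃ i, B (N (s i)) (r i)
    · exact ⟨h.choose, fun _ => h.choose_spec⟩
    · exact ⟨x₀, fun h' => absurd h' h⟩
  choose F hF using hF
  obtain ⟨D, hx₀, hDc, hD⟩ := exists_closed_under_mk_le_continuum mk_separating_index_le x₀ F
  refine ⟨D, fun z => ?_, hDc⟩
  by_contra hz
  have hpt : ∀ y : closure D, ∃ s : ℕ → X, ∃ r, (∀ j, s j ∈ D) ∧ (y : X) ∈ B (N s) r ∧
      z ∉ B (N s) r := by
    rintro ⟨y, hy⟩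
    obtain ⟨n, hn⟩ := mem_iUnion.1 (hA.symm.subset (mem_univ y))
    obtain ⟨C, hCZ, hC, hyC⟩ := htight n (⋃ d : D, range (σ d n))
      (iUnion_subset fun d => by rintro _ ⟨k, rfl⟩; exact hσA _ _ _) y hn
      (closure_minimal (fun d hd => closure_mono
        (subset_iUnion (fun d : D => range (σ d n)) ⟨d, hd⟩) (hσ d n)) isClosed_closure hy)
    have hCne : C.Nonempty := closure_nonempty_iff.1 ⟨y, hyC⟩
    obtain ⟨c, rfl⟩ := hC.exists_eq_range hCne
    choose d hd using fun j => mem_iUnion.1 (hCZ (mem_range_self j))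
    have hcl : y ∈ closure (range (N fun j => (d j : X))) := by
      refine closure_mono ?_ hyC
      rintro _ ⟨j, rfl⟩
      obtain ⟨k, hk⟩ := hd j
      exact hk ▸ hN (fun j => (d j : X)) j n k
    obtain ⟨r, hr⟩ := hB _ y hcl z (by rintro rfl; exact hz hy)
    exact ⟨_, r, fun j => (d j).2, hr⟩
  choose s r hsD hyB hzB using hpt
  obtain ⟨t, ht⟩ := isClosed_closure.isCompact.elim_finite_subcover
    (fun y : closure D => B (N (s y)) (r y)) (fun y => hBo _ _)
    (fun y hy => mem_iUnion.2 ⟨⟨y, hy⟩, hyB _⟩)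
  have htne : (t : Set (closure D)).Nonempty := by
    obtain ⟨y, hy, -⟩ := mem_iUnion₂.1 (ht (subset_closure hx₀))
    exact ⟨y, hy⟩
  -- The finite subcover is listed as a sequence, with repetitions, to fit the countable arity of
  -- `F`.
  obtain ⟨e, he⟩ := t.countable_toSet.exists_eq_range htne
  have h1 : F (fun i => r (e i)) (fun i => s (e i)) ∈ D := hD _ _ fun i j => hsD _ _
  refine hF (fun i => r (e i)) (fun i => s (e i)) ⟨z, by simp [hzB]⟩ ?_
  obtain ⟨y, hyt, hy⟩ := mem_iUnion₂.1 (ht (subset_closure h1))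
  obtain ⟨i, rfl⟩ := he.subset hyt
  exact mem_iUnion.2 ⟨i, hy⟩

/-! ### Cardinality of the homogeneous space -/

theorem HomogeneousSpace.mk_le_continuum_of_dense {X : Type u} [TopologicalSpace X] [T2Space X]
    (hX : HomogeneousSpace X) {p : X} (hp : HasCountablePiBaseAt p) {D : Set X} (hD : Dense D)
    (hDc : #D ≤ 𝔠) : #X ≤ 𝔠 := by
  obtain ⟨V, hV, hVp⟩ := hp
  choose h hh using hX p
  have hmeet : ∀ x i, ∃ d : D, (d : X) ∈ h x '' V i := by
    intro x i
    obtain ⟨d, hd, hdD⟩ := hD.inter_open_nonempty _ ((h x).isOpenMap _ (hV i).1)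
      ((hV i).2.image (h x))
    exact ⟨⟨d, hdD⟩, hd⟩
  choose φ hφ using hmeet
  have hinj : Function.Injective φ := by
    intro x y hxy
    by_contra hne
    obtain ⟨O₁, O₂, hO₁, hO₂, hx, hy, hO⟩ := t2_separation hne
    -- One neighbourhood of `p` serves both homeomorphisms, so a single `V i` has its two images in
    -- disjoint sets.
    obtain ⟨i, hi⟩ := hVp (h x ⁻¹' O₁ ∩ h y ⁻¹' O₂)
      ((hO₁.preimage (h x).continuous).inter (hO₂.preimage (h y).continuous))
      ⟨by simpa [hh] using hx, by simpa [hh] using hy⟩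
    have h1 : (φ x i : X) ∈ O₁ := image_subset_iff.2 (fun v hv => (hi hv).1) (hφ x i)
    have h2 : (φ y i : X) ∈ O₂ := image_subset_iff.2 (fun v hv => (hi hv).2) (hφ y i)
    rw [hxy] at h1
    exact Set.disjoint_left.1 hO h1 h2
  calc #X ≤ #(ℕ → D) := Cardinal.mk_le_of_injective hinj
    _ = #D ^ ℵ₀ := by simp
    _ ≤ 𝔠 ^ ℵ₀ := Cardinal.power_le_power_right hDc
    _ = 𝔠 := Cardinal.continuum_power_aleph0

theorem HomogeneousSpace.mk_le_continuum {X : Type u} [TopologicalSpace X] [CompactSpace X]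
    [T2Space X] [Nonempty X] (hX : HomogeneousSpace X) {A : ℕ → Set X} (hA : ⋃ n, A n = univ)
    (hdense : ∀ n, Dense (A n))
    (htight : ∀ n, ∀ Z ⊆ A n, ∀ y ∈ A n, y ∈ closure Z →
      ∃ C ⊆ Z, C.Countable ∧ y ∈ closure C) : #X ≤ 𝔠 := by
  obtain ⟨p, hp⟩ := exists_hasCountablePiBaseAt hA htight
  have hπ : ∀ x : X, HasCountablePiBaseAt x := fun x => by
    obtain ⟨h, rfl⟩ := hX p x
    exact hp.homeomorph h
  choose σ hσA hσ using fun x n => (hπ x).exists_seq_mem_closure (hdense n)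
  obtain ⟨K, S, -, hKG, ⟨q, hq⟩, hS, hKS⟩ :=
    exists_isGδ_subset_closure_countable hA htight σ hσA hσ
  obtain ⟨s, rfl⟩ := hS.exists_eq_range (closure_nonempty_iff.1 ⟨q, hKS hq⟩)
  obtain ⟨D, hD, hDc⟩ := exists_dense_mk_le_continuum hA htight σ hσA hσ fun x => by
    obtain ⟨h, rfl⟩ := hX q x
    refine ⟨h.symm ⁻¹' K, h ∘ s, hKG.preimage h.symm.continuous, by simpa using hq, ?_⟩
    rw [← h.image_eq_preimage_symm, range_comp, ← h.image_closure]
    exact image_mono hKS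
  exact hX.mk_le_continuum_of_dense hp hD hDc

theorem lindelofNumber_le_of_mk_le {X : Type u} [TopologicalSpace X] {κ : Cardinal.{u}}
    (hκ : ℵ₀ ≤ κ) (hX : #X ≤ κ) : lindelofNumber X ≤ κ := by
  refine csInf_le' ⟨hκ, fun 𝒰 _ h𝒰 => ?_⟩
  choose U hU hxU using fun x : X => h𝒰.symm.subset (mem_univ x)
  refine ⟨range U, range_subset_iff.2 hU, ?_, Cardinal.mk_range_le.trans hX⟩
  exact eq_univ_of_forall fun x => ⟨U x, mem_range_self x, hxU x⟩

theorem CountablyTight.exists_countable_subset {X : Type u} [TopologicalSpace X] {A : Set X}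
    (hA : CountablyTight A) {Z : Set X} (hZ : Z ⊆ A) {y : X} (hy : y ∈ A) (hyZ : y ∈ closure Z) :
    ∃ C ⊆ Z, C.Countable ∧ y ∈ closure C := by
  have hcl : (⟨y, hy⟩ : A) ∈ closure ((↑) ⁻¹' Z : Set A) := by
    rw [closure_subtype, Subtype.image_preimage_coe, inter_eq_right.2 hZ]
    exact hyZ
  obtain ⟨C, hCZ, hC, hyC⟩ := hA _ _ hcl
  exact ⟨(↑) '' C, image_subset_iff.2 hCZ, hC.image _, closure_subtype.1 hyC⟩

theorem mainTheorem4 (X : Type u) [TopologicalSpace X] [CompactSpace X] [T2Space X]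
    (hX : HomogeneousSpace X)
    (𝒜 : Set (Set X)) (h𝒜 : 𝒜.Countable) (hcover : ⋃₀ 𝒜 = univ)
    (hdense : ∀ A ∈ 𝒜, Dense A) (htight : ∀ A ∈ 𝒜, CountablyTight A) :
    @lindelofNumber X (gdeltaTopology X) ≤ 2 ^ ℵ₀ := by
  rw [Cardinal.two_power_aleph0]
  refine @lindelofNumber_le_of_mk_le X (gdeltaTopology X) _ Cardinal.aleph0_le_continuum ?_
  rcases isEmpty_or_nonempty X with hempty | hne
  · simp
  have h𝒜ne : 𝒜.Nonempty := by
    obtain ⟨A, hA, -⟩ := hcover.symm.subset (mem_univ (Classical.arbitrary X))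
    exact ⟨A, hA⟩
  obtain ⟨A, rfl⟩ := h𝒜.exists_eq_range h𝒜ne
  exact hX.mk_le_continuum (by rwa [sUnion_range] at hcover)
    (fun n => hdense _ (mem_range_self n))
    fun n Z hZ y hy => (htight _ (mem_range_self n)).exists_countable_subset hZ hy
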